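/- **Setting.** Let $d,n\ge 1$. Alice and Bob each hold $n$ copies of a $d$-level system. Alice's single-copy Hamiltonian $\sum_i E^A_i|i\rangle\langle i|$ and Bob's $\sum_i E^B_i|i\rangle\langle i|$ are non-degenerate, and $H_A$, $H_B$ denote the $n$-copy Hamiltonians, with eigenvectors $|\mathbf i\rangle$, $\mathbf i\in\{1,\dots,d\}^n$, and energies $\sum_k E^A_{i_k}$, $\sum_k E^B_{i_k}$. Assume that both have the same degenerate subspaces: $|\mathbf i\rangle,|\mathbf j\rangle$ have equal energy for $H_A$ if and only if they do for $H_B$. Let $D_{\rm deg}$ (resp. $D_{\rm ndeg}$) be the sum of the dimensions of the eigenspaces of $H_A$ of dimension at least two (resp. exactly one). The parties share $|\Psi\rangle=|\Psi_{+d}\rangle^{\otimes n}$ with $|\Psi_{+d}\rangle=d^{-1/2}\sum_i|ii\rangle$. **Operations.** A thermal operation at inverse temperature $\beta$ on a system with Hamiltonian $H$ is a map $\rho\mapsto \mathrm{Tr}_E[U(\rho\otimes\gamma_E)U^\dagger]$, where the bath is finite-dimensional with Hamiltonian $H_E$, $\gamma_E=e^{-\beta H_E}/\mathrm{Tr}\,e^{-\beta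 H_E}$, and $U$ is a unitary with $[U,H\otimes 1+1\otimes H_E]=0$. Alice and Bob have inverse temperatures $\beta_A,\beta_B$. In one round of LTOCC one party makes a projective measurement whose projectors commute with the local Hamiltonian and communicates the outcome; the other party applies a thermal operation conditioned on the outcome, the measuring party an unconditioned thermal operation, and the outcome is erased. LTOCC consists of all finite compositions of such rounds. In LTOCC with memory (LTOCC+M) each outcome is kept in a classical register: in every round the measurement and the measuring party's thermal operation may depend on all earlier outcomes, and the other party's thermal operation on all earlier outcomes and the new one; the registers are traced out at the end. The protocol does not depend on the measurement settings of the CHSH test. **Theorem.** Let $\Lambda$ be a map realised by an LTOCC protocol or by an LTOCC+M protocol with any number of rounds, and let $\sigma=\Lambda(|\Psi\rangle\langle\Psi|)$. Let $A_0,A_1$ (resp. $B_0,B_1$) be observables of two-outcome $\pm1$ energy-incoherent measurements of Alice (resp. Bob), i.e. Hermitian operators with $-1\le A_x\le 1$, $[A_x,H_A]=0$ and $-1\le B_y\le 1$, $[B_y,H_B]=0$. Then $$\bigl|\mathrm{Tr}\bigl[(A_0\otimes B_0+A_0\otimes B_1-A_1\otimes B_0+A_1\otimes B_1)\,\sigma\bigr]\bigr|\;\le\;2\,\frac{D_{\rm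 ndeg}+\sqrt2\,D_{\rm deg}}{d^n}.$$ For LTOCC+M the same bound also holds when the registers are kept until the end and the observables $A_x,B_y$ may depend on their content $m$: if $\sigma_m$ is the unnormalised final state belonging to $m$, then $$\Bigl|\sum_m\mathrm{Tr}\bigl[(A_0^m\otimes B_0^m+A_0^m\otimes B_1^m-A_1^m\otimes B_0^m+A_1^m\otimes B_1^m)\,\sigma_m\bigr]\Bigr|\;\le\;2\,\frac{D_{\rm ndeg}+\sqrt2\,D_{\rm deg}}{d^n}.$$ -/

import Mathlib

open scoped Kronecker ComplexOrder

noncomputable section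

namespace LTOCC

variable {a b e : Type} [Fintype a] [DecidableEq a] [Fintype b] [DecidableEq b]
  [Fintype e] [DecidableEq e]

/-! ### Thermal operations on a finite-dimensional system -/

/-- A linear map on operators of the system with basis `a`. -/
abbrev SuperOp (a : Type) : Type := Matrix a a ℂ →ₗ[ℂ] Matrix a a ℂ

/-- Operators of the bipartite system (Alice with basis `a`, Bob with basis `b`). -/
abbrev Bip (a b : Type) : Type := Matrix (a × b) (a × b) ℂ

/-- The partial trace over the second tensor factor. -/
def traceOut (X : Matrix (a × e) (a × e) ℂ) : Matrix a a ℂ :=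
  Matrix.of fun i j => ∑ k, X (i, k) (j, k)

/-- The Gibbs state `exp (-β H) / Tr (exp (-β H))`. -/
def gibbs (β : ℝ) (H : Matrix e e ℂ) : Matrix e e ℂ :=
  (NormedSpace.exp (-(β : ℂ) • H)).trace⁻¹ • NormedSpace.exp (-(β : ℂ) • H)

/-- `T` is a thermal operation at inverse temperature `β` for a system with Hamiltonian `H`:
`T ρ = Tr_E [U (ρ ⊗ γ_E) U†]` for a finite-dimensional bath with Hamiltonian `HE` in its Gibbs
state `γ_E`, and a unitary `U` that commutes with the total Hamiltonian `H ⊗ 1 + 1 ⊗ HE`. -/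
def IsThermalOp (β : ℝ) (H : Matrix a a ℂ) (T : SuperOp a) : Prop :=
  ∃ (m : ℕ) (HE : Matrix (Fin m) (Fin m) ℂ) (U : Matrix (a × Fin m) (a × Fin m) ℂ),
    0 < m ∧ HE.IsHermitian ∧ U ∈ Matrix.unitaryGroup (a × Fin m) ℂ ∧
      Commute U (H ⊗ₖ (1 : Matrix (Fin m) (Fin m) ℂ) + (1 : Matrix a a ℂ) ⊗ₖ HE) ∧
      ∀ ρ, T ρ = traceOut (U * (ρ ⊗ₖ gibbs β HE) * U.conjTranspose)

/-- The product map `S ⊗ T` on bipartite operators, the linear extension of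
`ρ ⊗ σ ↦ S ρ ⊗ T σ`. -/
def prodOp (S : SuperOp a) (T : SuperOp b) (X : Bip a b) : Bip a b :=
  ∑ i, ∑ k, ∑ j, ∑ l,
    X (i, j) (k, l) • (S (Matrix.single i k 1) ⊗ₖ T (Matrix.single j l 1))

/-! ### Energy-incoherent measurements -/

/-- `P` is a projective measurement (mutually orthogonal projectors with sum one) that is
energy-incoherent: every projector commutes with the Hamiltonian. -/
def IsIncoherentPVM {N : ℕ} (H : Matrix a a ℂ) (P : Fin N → Matrix a a ℂ) : Prop :=
  (∀ k, (P k).IsHermitian) ∧ (∀ k, P k * P k = P k) ∧ (∀ k l, k ≠ l → P k * P l = 0) ∧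
    ∑ k, P k = 1 ∧ ∀ k, Commute (P k) H

/-- Unnormalised state after Alice's outcome with projector `P`. -/
def projA (P : Matrix a a ℂ) (ρ : Bip a b) : Bip a b :=
  (P ⊗ₖ (1 : Matrix b b ℂ)) * ρ * (P ⊗ₖ (1 : Matrix b b ℂ))

/-- Unnormalised state after Bob's outcome with projector `P`. -/
def projB (P : Matrix b b ℂ) (ρ : Bip a b) : Bip a b :=
  ((1 : Matrix a a ℂ) ⊗ₖ P) * ρ * ((1 : Matrix a a ℂ) ⊗ₖ P)

/-- `A` is the expectation-value operator `E₊ - E₋` of a two-outcome (`±1`) measurement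
`(E₊, E₋)` that is energy-incoherent. Projective observables (`A * A = 1`), also when a thermal
operation is applied before they are measured, are of this kind. -/
def IsIncoherentObservable (H A : Matrix a a ℂ) : Prop :=
  A.IsHermitian ∧ (1 - A).PosSemidef ∧ (1 + A).PosSemidef ∧ Commute A H

/-! ### LTOCC without memory -/

/-- One round without memory: one party performs an energy-incoherent projective measurement and
sends the outcome to the other party, who applies a thermal operation conditioned on it; the
measuring party applies an unconditioned thermal operation; the outcome is then erased. -/
def IsRound (βA βB : ℝ) (HA : Matrix a a ℂ) (HB : Matrix b b ℂ) (R : Bip a b → Bip a b) : Prop :=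
  (∃ (N : ℕ) (P : Fin N → Matrix a a ℂ) (S : SuperOp a) (T : Fin N → SuperOp b),
    IsIncoherentPVM HA P ∧ IsThermalOp βA HA S ∧ (∀ k, IsThermalOp βB HB (T k)) ∧
      ∀ ρ, R ρ = ∑ k, prodOp S (T k) (projA (P k) ρ)) ∨
  (∃ (N : ℕ) (P : Fin N → Matrix b b ℂ) (S : Fin N → SuperOp a) (T : SuperOp b),
    IsIncoherentPVM HB P ∧ (∀ k, IsThermalOp βA HA (S k)) ∧ IsThermalOp βB HB T ∧
      ∀ ρ, R ρ = ∑ k, prodOp (S k) T (projB (P k) ρ))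

/-- `IsLTOCC βA βB HA HB r Λ`: the map `Λ` is a composition of `r` rounds without memory. -/
inductive IsLTOCC (βA βB : ℝ) (HA : Matrix a a ℂ) (HB : Matrix b b ℂ) :
    ℕ → (Bip a b → Bip a b) → Prop
  | zero : IsLTOCC βA βB HA HB 0 id
  | succ {r : ℕ} {Λ R : Bip a b → Bip a b} :
      IsLTOCC βA βB HA HB r Λ → IsRound βA βB HA HB R → IsLTOCC βA βB HA HB (r + 1) (R ∘ Λ)

/-! ### LTOCC with memory -/

/-- A state of the bipartite system together with `r` classical registers with values in `Fin N`:
to each register content belongs an unnormalised state. -/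
abbrev MemState (a b : Type) (N r : ℕ) : Type := (Fin r → Fin N) → Bip a b

/-- One round with memory. One party performs an energy-incoherent projective measurement, whose
outcome is written to a new register `m (Fin.last r)`. The measuring party then applies a thermal
operation conditioned on the old registers `Fin.init m`, the other party one conditioned on all
registers `m`. The choice of the measurement may depend on the old registers. -/
def IsMemRound (βA βB : ℝ) (HA : Matrix a a ℂ) (HB : Matrix b b ℂ) {N r : ℕ}
    (R : MemState a b N r → MemState a b N (r + 1)) : Prop :=
  (∃ (P : (Fin r → Fin N) → Fin N → Matrix a a ℂ) (S : (Fin r → Fin N) → SuperOp a)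
      (T : (Fin (r + 1) → Fin N) → SuperOp b),
    (∀ m, IsIncoherentPVM HA (P m)) ∧ (∀ m, IsThermalOp βA HA (S m)) ∧
      (∀ m, IsThermalOp βB HB (T m)) ∧
      ∀ (ρ : MemState a b N r) (m : Fin (r + 1) → Fin N),
        R ρ m = prodOp (S (Fin.init m)) (T m)
          (projA (P (Fin.init m) (m (Fin.last r))) (ρ (Fin.init m)))) ∨
  (∃ (P : (Fin r → Fin N) → Fin N → Matrix b b ℂ) (S : (Fin (r + 1) → Fin N) → SuperOp a)
      (T : (Fin r → Fin N) → SuperOp b),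
    (∀ m, IsIncoherentPVM HB (P m)) ∧ (∀ m, IsThermalOp βA HA (S m)) ∧
      (∀ m, IsThermalOp βB HB (T m)) ∧
      ∀ (ρ : MemState a b N r) (m : Fin (r + 1) → Fin N),
        R ρ m = prodOp (S m) (T (Fin.init m))
          (projB (P (Fin.init m) (m (Fin.last r))) (ρ (Fin.init m))))

/-- `IsMemProtocol βA βB HA HB N r F`: the map `F`, from states to states with `r` registers,
is realised by `r` consecutive rounds with memory, starting with no register. -/
inductive IsMemProtocol (βA βB : ℝ) (HA : Matrix a a ℂ) (HB : Matrix b b ℂ) (N : ℕ) :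
    (r : ℕ) → (Bip a b → MemState a b N r) → Prop
  | zero : IsMemProtocol βA βB HA HB N 0 (fun ρ _ => ρ)
  | succ {r : ℕ} {F : Bip a b → MemState a b N r}
      {R : MemState a b N r → MemState a b N (r + 1)} :
      IsMemProtocol βA βB HA HB N r F → IsMemRound βA βB HA HB R →
        IsMemProtocol βA βB HA HB N (r + 1) (R ∘ F)

/-- `IsLTOCCM βA βB HA HB r Λ`: the map `Λ` is realised by `r` rounds with memory, after which
the registers are traced out. -/
def IsLTOCCM (βA βB : ℝ) (HA : Matrix a a ℂ) (HB : Matrix b b ℂ) (r : ℕ)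
    (Λ : Bip a b → Bip a b) : Prop :=
  ∃ (N : ℕ) (F : Bip a b → MemState a b N r),
    IsMemProtocol βA βB HA HB N r F ∧ ∀ ρ, Λ ρ = ∑ m, F ρ m

/-! ### The CHSH expression -/

/-- The operator `A₀ ⊗ B₀ + A₀ ⊗ B₁ - A₁ ⊗ B₀ + A₁ ⊗ B₁`. -/
def chshOp (A : Fin 2 → Matrix a a ℂ) (B : Fin 2 → Matrix b b ℂ) : Bip a b :=
  A 0 ⊗ₖ B 0 + A 0 ⊗ₖ B 1 - A 1 ⊗ₖ B 0 + A 1 ⊗ₖ B 1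

/-- The expectation of the CHSH operator in the state `ρ`. -/
def chsh (A : Fin 2 → Matrix a a ℂ) (B : Fin 2 → Matrix b b ℂ) (ρ : Bip a b) : ℂ :=
  (chshOp A B * ρ).trace

/-! ### `n` copies of a `d`-level system -/

/-- The energy of the product eigenvector `i` of `n` non-interacting copies of a system with
energy levels `E`. -/
def energy {d : ℕ} (n : ℕ) (E : Fin d → ℝ) (i : Fin n → Fin d) : ℝ := ∑ k, E (i k)

/-- The `n`-copy Hamiltonian, in the product energy eigenbasis. -/
def hamiltonian {d : ℕ} (n : ℕ) (E : Fin d → ℝ) : Matrix (Fin n → Fin d) (Fin n → Fin d) ℂ :=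
  Matrix.diagonal fun i => (energy n E i : ℂ)

/-- The dimension of the eigenspace of the `n`-copy Hamiltonian for the energy `x`. -/
def levelDim {d : ℕ} (n : ℕ) (E : Fin d → ℝ) (x : ℝ) : ℕ :=
  (Finset.univ.filter fun i : Fin n → Fin d => energy n E i = x).card

/-- The energy levels of the `n`-copy Hamiltonian. -/
def levels {d : ℕ} (n : ℕ) (E : Fin d → ℝ) : Finset ℝ := Finset.univ.image (energy n E)

/-- The sum of the dimensions of the degenerate energy eigenspaces. -/
def Ddeg {d : ℕ} (n : ℕ) (E : Fin d → ℝ) : ℕ :=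
  ∑ x ∈ (levels n E).filter (fun x => 2 ≤ levelDim n E x), levelDim n E x

/-- The sum of the dimensions of the non-degenerate energy eigenspaces. -/
def Dndeg {d : ℕ} (n : ℕ) (E : Fin d → ℝ) : ℕ :=
  ∑ x ∈ (levels n E).filter (fun x => levelDim n E x = 1), levelDim n E x

/-- The maximally entangled vector `d ^ (-1/2) ∑ i, |i i⟩` of two `d`-level systems. -/
def maxEnt (d : ℕ) : Fin d × Fin d → ℂ :=
  fun p => if p.1 = p.2 then ((Real.sqrt d)⁻¹ : ℝ) else 0

/-- The vector of `n` copies of `ψ`, with Alice holding all first and Bob all second factors. -/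
def copies {d : ℕ} (n : ℕ) (ψ : Fin d × Fin d → ℂ) : (Fin n → Fin d) × (Fin n → Fin d) → ℂ :=
  fun p => ∏ k, ψ (p.1 k, p.2 k)

/-- The density operator `|Ψ⟩⟨Ψ|` of `n` copies of the maximally entangled vector. -/
def sharedState (d n : ℕ) : Bip (Fin n → Fin d) (Fin n → Fin d) :=
  Matrix.vecMulVec (copies n (maxEnt d)) (star (copies n (maxEnt d)))

/-- The thermal CHSH bound `2 (D_ndeg + √2 D_deg) / d ^ n`. -/
def chshBound {d : ℕ} (n : ℕ) (E : Fin d → ℝ) : ℝ :=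
  2 * ((Dndeg n E : ℝ) + Real.sqrt 2 * (Ddeg n E : ℝ)) / (d : ℝ) ^ n

end LTOCC

end

set_option linter.unusedSectionVars false

namespace LTOCC

open Matrix

variable {a b e : Type} [Fintype a] [DecidableEq a] [Fintype b] [DecidableEq b]
  [Fintype e] [DecidableEq e]

/-! ### Energy-shifting Kraus operators -/

/-- `K` changes the energy with respect to `H` by a fixed amount. -/
def IsEnergyShift (H K : Matrix a a ℂ) : Prop :=
  ∃ ω : ℝ, H * K = K * H + (ω : ℂ) • K

lemma IsEnergyShift.mul {H K L : Matrix a a ℂ} (hK : IsEnergyShift H K)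
    (hL : IsEnergyShift H L) : IsEnergyShift H (K * L) := by
  obtain ⟨ω, hω⟩ := hK
  obtain ⟨τ, hτ⟩ := hL
  refine ⟨τ + ω, ?_⟩
  rw [← Matrix.mul_assoc, hω, Matrix.add_mul, Matrix.mul_assoc, hτ]
  push_cast
  simp only [Matrix.mul_add, Matrix.smul_mul, Matrix.mul_smul, add_smul, Matrix.mul_assoc]
  abel

lemma IsEnergyShift.of_commute {H K : Matrix a a ℂ} (h : Commute K H) : IsEnergyShift H K :=
  ⟨0, by simpa using h.eq.symm⟩

/-- Conjugation with an energy shift preserves commutation with the Hamiltonian. -/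
lemma IsEnergyShift.commute_conj {H K A : Matrix a a ℂ} (hH : H.IsHermitian)
    (hK : IsEnergyShift H K) (hA : Commute A H) : Commute (Kᴴ * A * K) H := by
  obtain ⟨ω, hω⟩ := hK
  have h2 : H * Kᴴ = Kᴴ * H - (ω : ℂ) • Kᴴ := by
    have := congrArg conjTranspose hω
    simp only [conjTranspose_mul, conjTranspose_add, conjTranspose_smul, hH.eq,
      Complex.star_def, Complex.conj_ofReal] at this
    rw [this]; abel
  have h3 : K * H = H * K - (ω : ℂ) • K := by rw [hω]; abel
  show Kᴴ * A * K * H = H * (Kᴴ * A * K)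
  calc Kᴴ * A * K * H = Kᴴ * A * (K * H) := by simp only [Matrix.mul_assoc]
    _ = Kᴴ * (A * H) * K - (ω : ℂ) • (Kᴴ * A * K) := by
        rw [h3]; simp only [Matrix.mul_sub, Matrix.mul_smul, Matrix.mul_assoc]
    _ = (H * Kᴴ) * A * K := by
        rw [hA.eq, h2]; simp only [Matrix.sub_mul, Matrix.smul_mul, Matrix.mul_assoc]
    _ = H * (Kᴴ * A * K) := by simp only [Matrix.mul_assoc]

/-- `S` has a finite, trace-preserving family of energy-shifting Kraus operators. -/
def HasShiftKraus (H : Matrix a a ℂ) (S : SuperOp a) : Prop :=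
  ∃ (κ : Type) (_ : Fintype κ) (K : κ → Matrix a a ℂ),
    (∀ k, IsEnergyShift H (K k)) ∧ ∑ k, (K k)ᴴ * K k = 1 ∧ ∀ ρ, S ρ = ∑ k, K k * ρ * (K k)ᴴ

lemma traceOut_one_kronecker_conj (V : Matrix e e ℂ) (hV : Vᴴ * V = 1)
    (X : Matrix (a × e) (a × e) ℂ) :
    traceOut (((1 : Matrix a a ℂ) ⊗ₖ V) * X * ((1 : Matrix a a ℂ) ⊗ₖ V)ᴴ) = traceOut X := by
  ext i j
  have key : ∀ Y : Matrix (a × e) (a × e) ℂ,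
      traceOut Y i j = (Y.submatrix (Prod.mk i) (Prod.mk j)).trace := fun Y => rfl
  have : (((1 : Matrix a a ℂ) ⊗ₖ V) * X * ((1 : Matrix a a ℂ) ⊗ₖ V)ᴴ).submatrix
      (Prod.mk i) (Prod.mk j) = V * X.submatrix (Prod.mk i) (Prod.mk j) * Vᴴ := by
    ext k l
    simp [Matrix.mul_apply, Fintype.sum_prod_type, Matrix.one_apply, apply_ite]
  rw [key, key, this, Matrix.trace_mul_cycle, hV, Matrix.one_mul]

/-- A dilation with a bath that is diagonal in the given basis. -/
lemma hasShiftKraus_of_diagonal_bath (H : Matrix a a ℂ) (S : SuperOp a) (ε p : e → ℝ)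
    (hp : ∀ k, 0 ≤ p k) (hp1 : ∑ k, p k = 1) (U : Matrix (a × e) (a × e) ℂ)
    (hU : Uᴴ * U = 1)
    (hc : Commute U (H ⊗ₖ (1 : Matrix e e ℂ) +
      (1 : Matrix a a ℂ) ⊗ₖ diagonal fun k => (ε k : ℂ)))
    (hS : ∀ ρ, S ρ = traceOut (U * (ρ ⊗ₖ diagonal fun k => (p k : ℂ)) * Uᴴ)) :
    HasShiftKraus H S := by
  have hpp : ∀ l, ((Real.sqrt (p l) : ℝ) : ℂ) * ((Real.sqrt (p l) : ℝ) : ℂ) = (p l : ℂ) := by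
    intro l
    rw [← Complex.ofReal_mul, Real.mul_self_sqrt (hp l)]
  refine ⟨e × e, inferInstance,
    fun q => ((Real.sqrt (p q.2) : ℝ) : ℂ) • U.submatrix (fun i => (i, q.1)) (fun j => (j, q.2)),
    fun q => ⟨ε q.2 - ε q.1, ?_⟩, ?_, fun ρ => ?_⟩
  · have h : H * U.submatrix (fun i => (i, q.1)) (fun j => (j, q.2)) =
        U.submatrix (fun i => (i, q.1)) (fun j => (j, q.2)) * H +
        ((ε q.2 - ε q.1 : ℝ) : ℂ) • U.submatrix (fun i => (i, q.1)) (fun j => (j, q.2)) := by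
      ext i j
      have := congrFun (congrFun hc.eq (i, q.1)) (j, q.2)
      simp only [Matrix.add_apply, Matrix.mul_apply, _root_.mul_add, _root_.add_mul,
        Finset.sum_add_distrib,
        Fintype.sum_prod_type, Matrix.kroneckerMap_apply, Matrix.one_apply,
        Matrix.diagonal_apply, mul_ite, ite_mul, mul_one, mul_zero, one_mul, zero_mul,
        Finset.sum_ite_eq, Finset.sum_ite_eq', Finset.mem_univ, if_true] at this
      simp only [Matrix.add_apply, Matrix.mul_apply, Matrix.submatrix_apply, Matrix.smul_apply,
        smul_eq_mul]
      push_cast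
      linear_combination -this
    rw [Matrix.mul_smul, h, Matrix.smul_mul, smul_add, smul_comm]
  · ext i j
    have hd : ∀ l, ∑ k, ∑ x, star (U (x, k) (i, l)) * U (x, k) (j, l)
        = (1 : Matrix a a ℂ) i j := by
      intro l
      have := congrFun (congrFun hU (i, l)) (j, l)
      simp only [Matrix.mul_apply, Fintype.sum_prod_type, conjTranspose_apply] at this
      rw [Finset.sum_comm, this]
      simp [Matrix.one_apply]
    simp only [Matrix.sum_apply, Matrix.mul_apply, conjTranspose_apply, Matrix.smul_apply,
      Matrix.submatrix_apply, Fintype.sum_prod_type, smul_eq_mul, star_mul', Complex.star_def,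
      Complex.conj_ofReal]
    rw [Finset.sum_comm]
    calc _ = ∑ l, (p l : ℂ) * ∑ k, ∑ x, star (U (x, k) (i, l)) * U (x, k) (j, l) := by
            refine Finset.sum_congr rfl fun l _ => ?_
            simp only [Finset.mul_sum]
            refine Finset.sum_congr rfl fun k _ => Finset.sum_congr rfl fun x _ => ?_
            rw [← hpp, Complex.star_def]; ring
      _ = _ := by
            simp only [hd]
            rw [← Finset.sum_mul, ← Complex.ofReal_sum, hp1]; simp
  · rw [hS]
    ext i j
    simp only [traceOut, Matrix.of_apply, Matrix.sum_apply, Matrix.mul_apply,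
      conjTranspose_apply, Matrix.smul_apply, Matrix.submatrix_apply, Fintype.sum_prod_type,
      smul_eq_mul, star_mul', Complex.star_def, Complex.conj_ofReal,
      Matrix.kroneckerMap_apply, Matrix.diagonal_apply, mul_ite, mul_zero,
      Finset.sum_ite_eq', Finset.mem_univ, if_true]
    refine Finset.sum_congr rfl fun k _ => ?_
    rw [Finset.sum_comm]
    refine Finset.sum_congr rfl fun l _ => Finset.sum_congr rfl fun x _ => ?_
    rw [Finset.sum_mul, Finset.sum_mul]
    refine Finset.sum_congr rfl fun y _ => ?_
    rw [← hpp]; ring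

lemma IsThermalOp.hasShiftKraus {β : ℝ} {H : Matrix a a ℂ} {S : SuperOp a}
    (h : IsThermalOp β H S) : HasShiftKraus H S := by
  obtain ⟨m, HE, U, hm, hE, hU, hc, hS⟩ := h
  have : Nonempty (Fin m) := ⟨⟨0, hm⟩⟩
  set V : Matrix (Fin m) (Fin m) ℂ := hE.eigenvectorUnitary.1
  set ε := hE.eigenvalues
  have hV1 : Vᴴ * V = 1 := (mem_unitaryGroup_iff').1 hE.eigenvectorUnitary.2
  have hV2 : V * Vᴴ = 1 := (mem_unitaryGroup_iff).1 hE.eigenvectorUnitary.2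
  have hspec : HE = V * (diagonal fun k => (ε k : ℂ)) * Vᴴ := by
    have := hE.spectral_theorem
    rw [Unitary.conjStarAlgAut_apply] at this
    exact this
  set w : Fin m → ℝ := fun k => Real.exp (-β * ε k)
  have hexp : NormedSpace.exp (-(β : ℂ) • HE) = V * (diagonal fun k => (w k : ℂ)) * Vᴴ := by
    have hVi : V⁻¹ = Vᴴ := Matrix.inv_eq_right_inv hV2
    have hVu : IsUnit V := IsUnit.of_mul_eq_one _ hV2
    rw [hspec, ← hVi, ← Matrix.smul_mul, ← Matrix.mul_smul, Matrix.exp_conj _ _ hVu,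
      ← Matrix.diagonal_smul, Matrix.exp_diagonal]
    congr 3
    ext k
    rw [Pi.coe_exp, ← Complex.exp_eq_exp_ℂ]
    simp [w]
  set Z : ℝ := ∑ k, w k
  have hZ : 0 < Z := Finset.sum_pos (fun k _ => Real.exp_pos _) Finset.univ_nonempty
  have hg : gibbs β HE = V * (diagonal fun k => ((w k / Z : ℝ) : ℂ)) * Vᴴ := by
    have htr : (NormedSpace.exp (-(β : ℂ) • HE)).trace = (Z : ℂ) := by
      rw [hexp, Matrix.trace_mul_cycle, hV1, Matrix.one_mul, Matrix.trace_diagonal]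
      simp [Z]
    rw [gibbs, htr, hexp, ← Matrix.smul_mul, ← Matrix.mul_smul, ← Matrix.diagonal_smul]
    congr 3
    ext k
    simp [div_eq_inv_mul]
  set W : Matrix (a × Fin m) (a × Fin m) ℂ := (1 : Matrix a a ℂ) ⊗ₖ V with hWdef
  have hWh : Wᴴ = (1 : Matrix a a ℂ) ⊗ₖ Vᴴ := by
    rw [hWdef, conjTranspose_kronecker, conjTranspose_one]
  have hW1 : Wᴴ * W = 1 := by
    rw [hWh, hWdef, ← mul_kronecker_mul, hV1, Matrix.one_mul, one_kronecker_one]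
  have hW2 : W * Wᴴ = 1 := by
    rw [hWh, hWdef, ← mul_kronecker_mul, hV2, Matrix.one_mul, one_kronecker_one]
  have hconj : ∀ (X : Matrix a a ℂ) (D : Matrix (Fin m) (Fin m) ℂ),
      X ⊗ₖ (V * D * Vᴴ) = W * (X ⊗ₖ D) * Wᴴ := by
    intro X D
    rw [hWh, hWdef, ← mul_kronecker_mul, ← mul_kronecker_mul, Matrix.one_mul, Matrix.mul_one]
  have cancel : ∀ X : Matrix (a × Fin m) (a × Fin m) ℂ, Wᴴ * (W * X) = X := fun X => by
    rw [← Matrix.mul_assoc, hW1, Matrix.one_mul]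
  have cancel' : ∀ X : Matrix (a × Fin m) (a × Fin m) ℂ, W * (Wᴴ * X) = X := fun X => by
    rw [← Matrix.mul_assoc, hW2, Matrix.one_mul]
  have hUU : Uᴴ * U = 1 := (mem_unitaryGroup_iff').1 hU
  refine hasShiftKraus_of_diagonal_bath H S ε (fun k => w k / Z)
    (fun k => div_nonneg (Real.exp_pos _).le hZ.le) ?_ (Wᴴ * U * W) ?_ ?_ fun ρ => ?_
  · rw [← Finset.sum_div, div_self hZ.ne']
  · simp only [conjTranspose_mul, conjTranspose_conjTranspose, Matrix.mul_assoc, cancel']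
    rw [← Matrix.mul_assoc Uᴴ, hUU, Matrix.one_mul, hW1]
  · have e1 : H ⊗ₖ (1 : Matrix (Fin m) (Fin m) ℂ) + (1 : Matrix a a ℂ) ⊗ₖ HE =
        W * (H ⊗ₖ (1 : Matrix (Fin m) (Fin m) ℂ) +
          (1 : Matrix a a ℂ) ⊗ₖ diagonal fun k => (ε k : ℂ)) * Wᴴ := by
      rw [Matrix.mul_add, Matrix.add_mul, ← hconj, ← hconj, ← hspec, Matrix.mul_one, hV2]
    rw [e1] at hc
    generalize H ⊗ₖ (1 : Matrix (Fin m) (Fin m) ℂ) +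
          (1 : Matrix a a ℂ) ⊗ₖ diagonal (fun k => (ε k : ℂ)) = X at hc
    have := congrArg (fun Y => Wᴴ * Y * W) hc.eq
    show Wᴴ * U * W * X = X * (Wᴴ * U * W)
    simpa only [Matrix.mul_assoc, cancel, hW1, Matrix.mul_one] using this
  · rw [hS, hg, hconj, ← traceOut_one_kronecker_conj V hV1 (Wᴴ * U * W * _ * _)]
    simp only [← hWdef, conjTranspose_mul, conjTranspose_conjTranspose, Matrix.mul_assoc,
      cancel']
    rw [hW2, Matrix.mul_one]

/-! ### Separable instruments -/

/-- The family of maps `ρ ↦ F ρ m` is an instrument with product Kraus operators `K ⊗ L`,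
where the operators `K` shift the energy with respect to `H`. -/
def IsSepInstrument (H : Matrix a a ℂ) {ι : Type} [Fintype ι] (F : Bip a b → ι → Bip a b) : Prop :=
  ∃ (κ : ι → Type) (_ : ∀ m, Fintype (κ m)) (K : ∀ m, κ m → Matrix a a ℂ)
    (L : ∀ m, κ m → Matrix b b ℂ), (∀ m k, IsEnergyShift H (K m k)) ∧
      ∑ m, ∑ k, (K m k ⊗ₖ L m k)ᴴ * (K m k ⊗ₖ L m k) = 1 ∧
      ∀ ρ m, F ρ m = ∑ k, (K m k ⊗ₖ L m k) * ρ * (K m k ⊗ₖ L m k)ᴴ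

lemma isSepInstrument_id (H : Matrix a a ℂ) {ι : Type} [Fintype ι] [Unique ι] :
    IsSepInstrument H (fun (ρ : Bip a b) (_ : ι) => ρ) :=
  ⟨fun _ => Unit, inferInstance, fun _ _ => 1, fun _ _ => 1,
    fun _ _ => .of_commute (Commute.one_left _), by simp, by simp⟩

lemma IsSepInstrument.bind {H : Matrix a a ℂ} {ι ι' : Type} [Fintype ι] [Fintype ι']
    {F : Bip a b → ι → Bip a b} {R : ι → Bip a b → ι' → Bip a b}
    (hF : IsSepInstrument H F) (hR : ∀ m, IsSepInstrument H (R m)) :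
    IsSepInstrument H (fun ρ (q : ι × ι') => R q.1 (F ρ q.1) q.2) := by
  obtain ⟨κ, _, K, L, hs, h1, h⟩ := hF
  choose κ' i' K' L' hs' h1' h' using hR
  refine ⟨fun q => κ q.1 × κ' q.1 q.2, fun q => inferInstance,
    fun q k => K' q.1 q.2 k.2 * K q.1 k.1, fun q k => L' q.1 q.2 k.2 * L q.1 k.1,
    fun q k => (hs' _ _ _).mul (hs _ _), ?_, ?_⟩
  · rw [← h1, Fintype.sum_prod_type]
    refine Finset.sum_congr rfl fun m _ => ?_
    simp only [Fintype.sum_prod_type, mul_kronecker_mul, conjTranspose_mul]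
    trans ∑ k : κ m, ∑ x, ∑ y : κ' m x, (K m k ⊗ₖ L m k)ᴴ * (K' m x y ⊗ₖ L' m x y)ᴴ *
      ((K' m x y ⊗ₖ L' m x y) * (K m k ⊗ₖ L m k))
    · symm
      rw [Finset.sum_comm]
    refine Finset.sum_congr rfl fun k _ => ?_
    calc _ = (K m k ⊗ₖ L m k)ᴴ * (∑ x, ∑ y, (K' m x y ⊗ₖ L' m x y)ᴴ * (K' m x y ⊗ₖ L' m x y)) *
          (K m k ⊗ₖ L m k) := by
            simp only [Finset.mul_sum, Finset.sum_mul, Matrix.mul_assoc]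
      _ = _ := by rw [h1', Matrix.mul_one]
  · rintro ρ ⟨m, x⟩
    simp only [h', h, Fintype.sum_prod_type, mul_kronecker_mul, conjTranspose_mul,
      Finset.mul_sum, Finset.sum_mul, Matrix.mul_assoc]
    rw [Finset.sum_comm]

lemma IsSepInstrument.reindex {H : Matrix a a ℂ} {ι ι' : Type} [Fintype ι] [Fintype ι']
    {F : Bip a b → ι → Bip a b} (hF : IsSepInstrument H F) (f : ι' ≃ ι) :
    IsSepInstrument H (fun ρ m => F ρ (f m)) := by
  obtain ⟨κ, _, K, L, hs, h1, h⟩ := hF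
  refine ⟨fun m => κ (f m), fun m => inferInstance, fun m => K (f m), fun m => L (f m),
    fun m => hs _, ?_, fun ρ m => h ρ _⟩
  rw [← h1]
  exact f.sum_comp fun m => ∑ k, (K m k ⊗ₖ L m k)ᴴ * (K m k ⊗ₖ L m k)

lemma IsSepInstrument.sum {H : Matrix a a ℂ} {ι : Type} [Fintype ι]
    {F : Bip a b → ι → Bip a b} (hF : IsSepInstrument H F) :
    IsSepInstrument H (fun ρ (_ : Unit) => ∑ m, F ρ m) := by
  obtain ⟨κ, _, K, L, hs, h1, h⟩ := hF
  refine ⟨fun _ => Σ m, κ m, fun _ => inferInstance, fun _ k => K k.1 k.2,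
    fun _ k => L k.1 k.2, fun _ k => hs _ _, ?_, fun ρ _ => ?_⟩
  · simpa [Fintype.sum_sigma] using h1
  · simp [h, Fintype.sum_sigma]

lemma sum_smul_single_kronecker_single (X : Bip a b) :
    ∑ i, ∑ k, ∑ j, ∑ l, X (i, j) (k, l) • (single i k (1 : ℂ) ⊗ₖ single j l (1 : ℂ)) = X := by
  ext ⟨p, q⟩ ⟨r, s⟩
  simp only [Matrix.sum_apply, Matrix.smul_apply, kroneckerMap_apply, Matrix.single_apply,
    smul_eq_mul, mul_ite, mul_one, mul_zero, ite_and]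
  simp

lemma prodOp_eq_sum {S : SuperOp a} {T : SuperOp b} {κ τ : Type} [Fintype κ] [Fintype τ]
    {K : κ → Matrix a a ℂ} {L : τ → Matrix b b ℂ} (hS : ∀ ρ, S ρ = ∑ k, K k * ρ * (K k)ᴴ)
    (hT : ∀ ρ, T ρ = ∑ l, L l * ρ * (L l)ᴴ) (X : Bip a b) :
    prodOp S T X = ∑ k, ∑ l, (K k ⊗ₖ L l) * X * (K k ⊗ₖ L l)ᴴ := by
  let Φ : Bip a b →ₗ[ℂ] Bip a b := ∑ k, ∑ l,
    (LinearMap.mulRight ℂ (K k ⊗ₖ L l)ᴴ) ∘ₗ (LinearMap.mulLeft ℂ (K k ⊗ₖ L l))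
  have hΦ : ∀ Y, Φ Y = ∑ k, ∑ l, (K k ⊗ₖ L l) * Y * (K k ⊗ₖ L l)ᴴ := fun Y => by
    simp [Φ, LinearMap.sum_apply]
  have hprod : ∀ (Y : Matrix a a ℂ) (Z : Matrix b b ℂ), Φ (Y ⊗ₖ Z) = S Y ⊗ₖ T Z := by
    intro Y Z
    rw [hΦ, hS, hT]
    simp only [conjTranspose_kronecker, ← mul_kronecker_mul]
    ext ⟨p, q⟩ ⟨r, s⟩
    simp only [Matrix.sum_apply, kroneckerMap_apply, Finset.sum_mul_sum]
  rw [← hΦ]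
  conv_rhs => rw [← sum_smul_single_kronecker_single X]
  simp only [map_sum, map_smul, hprod, prodOp]

lemma sum_conj_of_sum_eq_one {κ : Type} [Fintype κ] {K : κ → Matrix a a ℂ}
    (h : ∑ k, (K k)ᴴ * K k = 1) {P : Matrix a a ℂ} (hP : P.IsHermitian) (hPP : P * P = P) :
    ∑ k, (K k * P)ᴴ * (K k * P) = P := by
  calc _ = P * (∑ k, (K k)ᴴ * K k) * P := by
        simp only [conjTranspose_mul, hP.eq, Finset.mul_sum, Finset.sum_mul, Matrix.mul_assoc]
    _ = P := by rw [h, Matrix.mul_one, hPP]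

lemma sum_kronecker_sum {κ τ : Type} [Fintype κ] [Fintype τ]
    (K : κ → Matrix a a ℂ) (L : τ → Matrix b b ℂ) :
    ∑ q : κ × τ, (K q.1 ⊗ₖ L q.2)ᴴ * (K q.1 ⊗ₖ L q.2) =
      (∑ k, (K k)ᴴ * K k) ⊗ₖ (∑ l, (L l)ᴴ * L l) := by
  simp only [conjTranspose_kronecker, ← mul_kronecker_mul]
  ext ⟨p, q⟩ ⟨r, s⟩
  simp only [Matrix.sum_apply, kroneckerMap_apply, Finset.sum_mul_sum, Fintype.sum_prod_type]

lemma isSepInstrument_projA {βA βB : ℝ} {HA : Matrix a a ℂ} {HB : Matrix b b ℂ} {N : ℕ}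
    {P : Fin N → Matrix a a ℂ} {S : SuperOp a} {T : Fin N → SuperOp b}
    (hP : IsIncoherentPVM HA P) (hS : IsThermalOp βA HA S) (hT : ∀ k, IsThermalOp βB HB (T k)) :
    IsSepInstrument HA (fun ρ k => prodOp S (T k) (projA (P k) ρ)) := by
  obtain ⟨κ, _, K, hKs, hK1, hK⟩ := hS.hasShiftKraus
  choose τ _ L hLs hL1 hL using fun k => (hT k).hasShiftKraus
  obtain ⟨hPh, hPP, -, hPs, hPc⟩ := hP
  refine ⟨fun k => κ × τ k, fun _ => inferInstance, fun k q => K q.1 * P k, fun k q => L k q.2,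
    fun k q => (hKs _).mul (.of_commute (hPc k)), ?_, fun ρ k => ?_⟩
  · have : ∀ m, ∑ q : κ × τ m, ((K q.1 * P m) ⊗ₖ L m q.2)ᴴ * ((K q.1 * P m) ⊗ₖ L m q.2) =
        P m ⊗ₖ (1 : Matrix b b ℂ) := fun m => by
      rw [sum_kronecker_sum (fun k => K k * P m) (L m), hL1,
        sum_conj_of_sum_eq_one hK1 (hPh m) (hPP m)]
    simp only [this]
    rw [← one_kronecker_one, ← hPs]
    ext ⟨p, q⟩ ⟨r, s⟩
    simp only [Matrix.sum_apply, kroneckerMap_apply, Finset.sum_mul]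
  · dsimp only
    rw [prodOp_eq_sum hK (hL k), projA, Fintype.sum_prod_type]
    refine Finset.sum_congr rfl fun x _ => Finset.sum_congr rfl fun y _ => ?_
    have : (K x * P k) ⊗ₖ L k y = (K x ⊗ₖ L k y) * (P k ⊗ₖ (1 : Matrix b b ℂ)) := by
      rw [← mul_kronecker_mul, Matrix.mul_one]
    rw [this, conjTranspose_mul, conjTranspose_kronecker (P k), (hPh k).eq, conjTranspose_one]
    simp only [Matrix.mul_assoc]

lemma isSepInstrument_projB {βA βB : ℝ} {HA : Matrix a a ℂ} {HB : Matrix b b ℂ} {N : ℕ}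
    {P : Fin N → Matrix b b ℂ} {S : Fin N → SuperOp a} {T : SuperOp b}
    (hP : IsIncoherentPVM HB P) (hS : ∀ k, IsThermalOp βA HA (S k)) (hT : IsThermalOp βB HB T) :
    IsSepInstrument HA (fun ρ k => prodOp (S k) T (projB (P k) ρ)) := by
  obtain ⟨τ, _, L, hLs, hL1, hL⟩ := hT.hasShiftKraus
  choose κ _ K hKs hK1 hK using fun k => (hS k).hasShiftKraus
  obtain ⟨hPh, hPP, -, hPs, hPc⟩ := hP
  refine ⟨fun k => κ k × τ, fun _ => inferInstance, fun k q => K k q.1, fun k q => L q.2 * P k,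
    fun k q => hKs _ _, ?_, fun ρ k => ?_⟩
  · have : ∀ m, ∑ q : κ m × τ, (K m q.1 ⊗ₖ (L q.2 * P m))ᴴ * (K m q.1 ⊗ₖ (L q.2 * P m)) =
        (1 : Matrix a a ℂ) ⊗ₖ P m := fun m => by
      rw [sum_kronecker_sum (K m) (fun l => L l * P m), hK1,
        sum_conj_of_sum_eq_one hL1 (hPh m) (hPP m)]
    simp only [this]
    rw [← one_kronecker_one, ← hPs]
    ext ⟨p, q⟩ ⟨r, s⟩
    simp only [Matrix.sum_apply, kroneckerMap_apply, Finset.mul_sum]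
  · dsimp only
    rw [prodOp_eq_sum (hK k) hL, projB, Fintype.sum_prod_type]
    refine Finset.sum_congr rfl fun x _ => Finset.sum_congr rfl fun y _ => ?_
    have : K k x ⊗ₖ (L y * P k) = (K k x ⊗ₖ L y) * ((1 : Matrix a a ℂ) ⊗ₖ P k) := by
      rw [← mul_kronecker_mul, Matrix.mul_one]
    rw [this, conjTranspose_mul, conjTranspose_kronecker _ (P k), (hPh k).eq, conjTranspose_one]
    simp only [Matrix.mul_assoc]

/-! ### Protocols are separable instruments -/

lemma IsRound.isSepInstrument {βA βB : ℝ} {HA : Matrix a a ℂ} {HB : Matrix b b ℂ}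
    {R : Bip a b → Bip a b} (h : IsRound βA βB HA HB R) :
    IsSepInstrument HA (fun ρ (_ : Unit) => R ρ) := by
  rcases h with ⟨N, P, S, T, hP, hS, hT, hR⟩ | ⟨N, P, S, T, hP, hS, hT, hR⟩
  · simpa only [hR] using (isSepInstrument_projA hP hS hT).sum
  · simpa only [hR] using (isSepInstrument_projB hP hS hT).sum

lemma IsLTOCC.isSepInstrument {βA βB : ℝ} {HA : Matrix a a ℂ} {HB : Matrix b b ℂ} {r : ℕ}
    {Λ : Bip a b → Bip a b} (h : IsLTOCC βA βB HA HB r Λ) :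
    IsSepInstrument HA (fun ρ (_ : Unit) => Λ ρ) := by
  induction h with
  | zero => exact isSepInstrument_id HA
  | succ _ hR ih =>
    exact (ih.bind fun _ => hR.isSepInstrument).reindex (Equiv.prodUnique Unit Unit).symm

lemma IsMemProtocol.isSepInstrument {βA βB : ℝ} {HA : Matrix a a ℂ} {HB : Matrix b b ℂ}
    {N r : ℕ} {F : Bip a b → MemState a b N r} (h : IsMemProtocol βA βB HA HB N r F) :
    IsSepInstrument HA F := by
  induction h with
  | zero => exact isSepInstrument_id HA
  | @succ r F R _ hR ih =>
    let f : (Fin (r + 1) → Fin N) ≃ (Fin r → Fin N) × Fin N :=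
      (Fin.snocEquiv fun _ => Fin N).symm.trans (Equiv.prodComm _ _)
    have hf : ∀ m, f m = (Fin.init m, m (Fin.last r)) := fun m => rfl
    rcases hR with ⟨P, S, T, hP, hS, hT, hR⟩ | ⟨P, S, T, hP, hS, hT, hR⟩
    · have := (ih.bind fun m => isSepInstrument_projA (T := fun k => T (Fin.snoc m k))
        (hP m) (hS m) fun k => hT _).reindex f
      simp only [hf, Fin.snoc_init_self] at this
      convert this using 3
      exact hR _ _
    · have := (ih.bind fun m => isSepInstrument_projB (S := fun k => S (Fin.snoc m k))
        (hP m) (fun k => hS _) (hT m)).reindex f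
      simp only [hf, Fin.snoc_init_self] at this
      convert this using 3
      exact hR _ _

/-! ### The Tsirelson bound -/

/-- The Euclidean norm of a vector. -/
noncomputable def l2norm (v : a → ℂ) : ℝ := ‖(WithLp.toLp 2 v : EuclideanSpace ℂ a)‖

lemma l2norm_nonneg (v : a → ℂ) : 0 ≤ l2norm v := norm_nonneg _

lemma l2norm_sq (v : a → ℂ) : l2norm v ^ 2 = (star v ⬝ᵥ v).re := by
  have := inner_self_eq_norm_sq (𝕜 := ℂ) (WithLp.toLp 2 v : EuclideanSpace ℂ a)
  rw [EuclideanSpace.inner_eq_star_dotProduct, dotProduct_comm] at this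
  exact this.symm

lemma norm_star_dotProduct_le (u v : a → ℂ) : ‖star u ⬝ᵥ v‖ ≤ l2norm u * l2norm v := by
  have := norm_inner_le_norm (𝕜 := ℂ) (WithLp.toLp 2 u : EuclideanSpace ℂ a) (WithLp.toLp 2 v)
  rwa [EuclideanSpace.inner_eq_star_dotProduct, dotProduct_comm] at this

lemma star_mulVec_dotProduct (M : Matrix a a ℂ) (u v : a → ℂ) :
    star (M *ᵥ u) ⬝ᵥ v = star u ⬝ᵥ (Mᴴ *ᵥ v) := by
  rw [star_mulVec, dotProduct_mulVec]

lemma l2norm_mulVec_le {M : Matrix a a ℂ} (h : (1 - Mᴴ * M).PosSemidef) (v : a → ℂ) :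
    l2norm (M *ᵥ v) ≤ l2norm v := by
  refine le_of_sq_le_sq ?_ (l2norm_nonneg v)
  rw [l2norm_sq, l2norm_sq, star_mulVec_dotProduct, mulVec_mulVec]
  have := h.re_dotProduct_nonneg v
  rw [sub_mulVec, one_mulVec, dotProduct_sub] at this
  simpa using this

lemma l2norm_add_sq_add_l2norm_sub_sq (u v : a → ℂ) :
    l2norm (u + v) ^ 2 + l2norm (v - u) ^ 2 = 2 * (l2norm u ^ 2 + l2norm v ^ 2) := by
  simp only [l2norm_sq, star_add, star_sub, add_dotProduct, dotProduct_add, sub_dotProduct,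
    dotProduct_sub, Complex.add_re, Complex.sub_re]
  ring

/-- Tsirelson's bound for contractions. -/
lemma tsirelson_of_contractions {A₀ A₁ B₀ B₁ : Matrix a a ℂ}
    (hA₀ : A₀.IsHermitian) (hA₁ : A₁.IsHermitian)
    (cA₀ : (1 - A₀ᴴ * A₀).PosSemidef) (cA₁ : (1 - A₁ᴴ * A₁).PosSemidef)
    (cB₀ : (1 - B₀ᴴ * B₀).PosSemidef) (cB₁ : (1 - B₁ᴴ * B₁).PosSemidef) (v : a → ℂ) :
    ‖star v ⬝ᵥ ((A₀ * B₀ + A₀ * B₁ - A₁ * B₀ + A₁ * B₁) *ᵥ v)‖ ≤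
      2 * Real.sqrt 2 * (star v ⬝ᵥ v).re := by
  set x := B₀ *ᵥ v
  set y := B₁ *ᵥ v
  have e : star v ⬝ᵥ ((A₀ * B₀ + A₀ * B₁ - A₁ * B₀ + A₁ * B₁) *ᵥ v) =
      star (A₀ *ᵥ v) ⬝ᵥ (x + y) + star (A₁ *ᵥ v) ⬝ᵥ (y - x) := by
    rw [star_mulVec_dotProduct, star_mulVec_dotProduct, hA₀.eq, hA₁.eq]
    simp only [add_mulVec, sub_mulVec, mulVec_add, mulVec_sub, ← mulVec_mulVec, dotProduct_add,
      dotProduct_sub]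
    ring
  rw [e, ← l2norm_sq]
  have h1 := norm_star_dotProduct_le (A₀ *ᵥ v) (x + y)
  have h2 := norm_star_dotProduct_le (A₁ *ᵥ v) (y - x)
  have h3 := l2norm_mulVec_le cA₀ v
  have h4 := l2norm_mulVec_le cA₁ v
  have h5 : l2norm x ≤ _ := l2norm_mulVec_le cB₀ v
  have h6 : l2norm y ≤ _ := l2norm_mulVec_le cB₁ v
  have h7 := l2norm_add_sq_add_l2norm_sub_sq x y
  have n := l2norm_nonneg v
  have h8 : l2norm (x + y) + l2norm (y - x) ≤ 2 * Real.sqrt 2 * l2norm v := by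
    refine abs_le_of_sq_le_sq' ?_ (by positivity) |>.2
    have s2 : Real.sqrt 2 ^ 2 = 2 := Real.sq_sqrt (by norm_num)
    have h9 := pow_le_pow_left₀ (l2norm_nonneg x) h5 2
    have h10 := pow_le_pow_left₀ (l2norm_nonneg y) h6 2
    rw [mul_pow, mul_pow, s2]
    nlinarith [sq_nonneg (l2norm (x + y) - l2norm (y - x))]
  calc _ ≤ _ := norm_add_le _ _
    _ ≤ l2norm v * l2norm (x + y) + l2norm v * l2norm (y - x) :=
        add_le_add (h1.trans (mul_le_mul_of_nonneg_right h3 (l2norm_nonneg _)))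
          (h2.trans (mul_le_mul_of_nonneg_right h4 (l2norm_nonneg _)))
    _ = l2norm v * (l2norm (x + y) + l2norm (y - x)) := by ring
    _ ≤ l2norm v * (2 * Real.sqrt 2 * l2norm v) := mul_le_mul_of_nonneg_left h8 n
    _ = _ := by ring

/-- A Hermitian operator between `-1` and `1` is a contraction. -/
lemma IsIncoherentObservable.contraction {H A : Matrix a a ℂ} (h : IsIncoherentObservable H A) :
    (1 - Aᴴ * A).PosSemidef := by
  obtain ⟨hA, hm, hp, -⟩ := h
  have h1 := hp.conjTranspose_mul_mul_same (1 - A)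
  have h2 := hm.conjTranspose_mul_mul_same (1 + A)
  have e : 1 - Aᴴ * A = (2⁻¹ : ℝ) •
      ((1 - A)ᴴ * (1 + A) * (1 - A) + (1 + A)ᴴ * (1 - A) * (1 + A)) := by
    rw [hm.isHermitian.eq, hp.isHermitian.eq, hA.eq]
    have : (1 - A) * (1 + A) * (1 - A) + (1 + A) * (1 - A) * (1 + A) = (2 : ℝ) • (1 - A * A) := by
      rw [two_smul]; noncomm_ring
    rw [this, smul_smul]; norm_num
  rw [e]
  exact (h1.add h2).smul (by norm_num)

lemma tsirelson {HA : Matrix a a ℂ} {HB : Matrix b b ℂ} {A : Fin 2 → Matrix a a ℂ}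
    {B : Fin 2 → Matrix b b ℂ} (hA : ∀ x, IsIncoherentObservable HA (A x))
    (hB : ∀ y, IsIncoherentObservable HB (B y)) (v : a × b → ℂ) :
    ‖star v ⬝ᵥ (chshOp A B *ᵥ v)‖ ≤ 2 * Real.sqrt 2 * (star v ⬝ᵥ v).re := by
  have cA : ∀ x, (1 - (A x ⊗ₖ (1 : Matrix b b ℂ))ᴴ * (A x ⊗ₖ (1 : Matrix b b ℂ))).PosSemidef := by
    intro x
    have := (hA x).contraction.kronecker (PosSemidef.one (n := b) (R := ℂ))
    rw [conjTranspose_kronecker, ← mul_kronecker_mul, conjTranspose_one, Matrix.one_mul]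
    rwa [show 1 - ((A x)ᴴ * A x) ⊗ₖ (1 : Matrix b b ℂ) = (1 - (A x)ᴴ * A x) ⊗ₖ (1 : Matrix b b ℂ) by
      rw [← one_kronecker_one]
      ext ⟨p, q⟩ ⟨r, s⟩
      simp only [Matrix.sub_apply, kroneckerMap_apply]
      ring]
  have cB : ∀ y, (1 - ((1 : Matrix a a ℂ) ⊗ₖ B y)ᴴ * ((1 : Matrix a a ℂ) ⊗ₖ B y)).PosSemidef := by
    intro y
    have := (PosSemidef.one (n := a) (R := ℂ)).kronecker (hB y).contraction
    rw [conjTranspose_kronecker, ← mul_kronecker_mul, conjTranspose_one, Matrix.one_mul]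
    rwa [show 1 - (1 : Matrix a a ℂ) ⊗ₖ ((B y)ᴴ * B y) = (1 : Matrix a a ℂ) ⊗ₖ (1 - (B y)ᴴ * B y) by
      rw [← one_kronecker_one]
      ext ⟨p, q⟩ ⟨r, s⟩
      simp only [Matrix.sub_apply, kroneckerMap_apply]
      ring]
  have hh : ∀ x, (A x ⊗ₖ (1 : Matrix b b ℂ)).IsHermitian := fun x => by
    rw [IsHermitian, conjTranspose_kronecker, (hA x).1.eq, conjTranspose_one]
  have := tsirelson_of_contractions (hh 0) (hh 1) (cA 0) (cA 1) (cB 0) (cB 1) v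
  simpa only [← mul_kronecker_mul, Matrix.one_mul, Matrix.mul_one, chshOp] using this

/-- The CHSH operator after conjugation with a product operator. -/
lemma conj_chshOp (A : Fin 2 → Matrix a a ℂ) (B : Fin 2 → Matrix b b ℂ) (K : Matrix a a ℂ)
    (L : Matrix b b ℂ) :
    (K ⊗ₖ L)ᴴ * chshOp A B * (K ⊗ₖ L) =
      chshOp (fun x => Kᴴ * A x * K) (fun y => Lᴴ * B y * L) := by
  simp only [chshOp, conjTranspose_kronecker, Matrix.mul_add, Matrix.mul_sub, Matrix.add_mul,
    Matrix.sub_mul, ← mul_kronecker_mul]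

lemma norm_conj_chshOp_le {HA : Matrix a a ℂ} {HB : Matrix b b ℂ} {A : Fin 2 → Matrix a a ℂ}
    {B : Fin 2 → Matrix b b ℂ} (hA : ∀ x, IsIncoherentObservable HA (A x))
    (hB : ∀ y, IsIncoherentObservable HB (B y)) (K : Matrix a a ℂ) (L : Matrix b b ℂ)
    (v : a × b → ℂ) :
    ‖star v ⬝ᵥ (((K ⊗ₖ L)ᴴ * chshOp A B * (K ⊗ₖ L)) *ᵥ v)‖ ≤
      2 * Real.sqrt 2 * (star v ⬝ᵥ (((K ⊗ₖ L)ᴴ * (K ⊗ₖ L)) *ᵥ v)).re := by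
  have := tsirelson hA hB ((K ⊗ₖ L) *ᵥ v)
  rwa [star_mulVec_dotProduct, star_mulVec_dotProduct, mulVec_mulVec, mulVec_mulVec,
    mulVec_mulVec] at this

/-- Diagonal entries of a transformed observable are real and bounded. -/
lemma IsIncoherentObservable.conj_apply_self {H A : Matrix a a ℂ}
    (h : IsIncoherentObservable H A) (K : Matrix a a ℂ) (p : a) :
    ∃ t : ℝ, (Kᴴ * A * K) p p = t ∧ |t| ≤ ((Kᴴ * K) p p).re := by
  obtain ⟨hA, hm, hp, -⟩ := h
  have hh : (Kᴴ * A * K).IsHermitian := isHermitian_conjTranspose_mul_mul K hA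
  have h1 := (hm.conjTranspose_mul_mul_same K).diag_nonneg (i := p)
  have h2 := (hp.conjTranspose_mul_mul_same K).diag_nonneg (i := p)
  rw [Matrix.mul_sub, Matrix.sub_mul, Matrix.mul_one, Matrix.sub_apply] at h1
  rw [Matrix.mul_add, Matrix.add_mul, Matrix.mul_one, Matrix.add_apply] at h2
  have h1' := (Complex.le_def.1 h1).1
  have h2' := (Complex.le_def.1 h2).1
  simp only [Complex.zero_re, Complex.sub_re, Complex.add_re] at h1' h2'
  exact ⟨((Kᴴ * A * K) p p).re, (hh.coe_re_apply_self p).symm,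
    abs_le.2 ⟨by linarith, by linarith⟩⟩

/-- The classical bound for product vectors. -/
lemma norm_conj_chshOp_apply_self_le {HA : Matrix a a ℂ} {HB : Matrix b b ℂ}
    {A : Fin 2 → Matrix a a ℂ}
    {B : Fin 2 → Matrix b b ℂ} (hA : ∀ x, IsIncoherentObservable HA (A x))
    (hB : ∀ y, IsIncoherentObservable HB (B y)) (K : Matrix a a ℂ) (L : Matrix b b ℂ)
    (p : a) (q : b) :
    ‖((K ⊗ₖ L)ᴴ * chshOp A B * (K ⊗ₖ L)) (p, q) (p, q)‖ ≤
      2 * (((K ⊗ₖ L)ᴴ * (K ⊗ₖ L)) (p, q) (p, q)).re := by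
  obtain ⟨a₀, e₀, l₀⟩ := (hA 0).conj_apply_self K p
  obtain ⟨a₁, e₁, l₁⟩ := (hA 1).conj_apply_self K p
  obtain ⟨b₀, f₀, m₀⟩ := (hB 0).conj_apply_self L q
  obtain ⟨b₁, f₁, m₁⟩ := (hB 1).conj_apply_self L q
  obtain ⟨s, hs⟩ : ∃ s : ℝ, (Kᴴ * K) p p = s :=
    ⟨_, ((isHermitian_conjTranspose_mul_self K).coe_re_apply_self p).symm⟩
  obtain ⟨t, ht⟩ : ∃ t : ℝ, (Lᴴ * L) q q = t :=
    ⟨_, ((isHermitian_conjTranspose_mul_self L).coe_re_apply_self q).symm⟩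
  rw [conj_chshOp, conjTranspose_kronecker, ← mul_kronecker_mul]
  simp only [chshOp, Matrix.add_apply, Matrix.sub_apply, kroneckerMap_apply, e₀, e₁, f₀, f₁]
  rw [hs] at l₀ l₁
  rw [ht] at m₀ m₁
  rw [hs, ht]
  simp only [Complex.ofReal_re, ← Complex.ofReal_mul, ← Complex.ofReal_add, ← Complex.ofReal_sub,
    Complex.norm_real, Real.norm_eq_abs] at *
  have h1 : |b₀ + b₁| + |b₁ - b₀| ≤ 2 * t := by
    rw [abs_le] at m₀ m₁
    rcases abs_cases (b₀ + b₁) with h | h <;> rcases abs_cases (b₁ - b₀) with h' | h' <;> linarith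
  have hs0 : 0 ≤ s := (abs_nonneg _).trans l₀
  calc |a₀ * b₀ + a₀ * b₁ - a₁ * b₀ + a₁ * b₁| = |a₀ * (b₀ + b₁) + a₁ * (b₁ - b₀)| := by
        congr 1; ring
    _ ≤ |a₀| * |b₀ + b₁| + |a₁| * |b₁ - b₀| := by
        rw [← abs_mul, ← abs_mul]; exact abs_add_le _ _
    _ ≤ s * |b₀ + b₁| + s * |b₁ - b₀| := by gcongr
    _ = s * (|b₀ + b₁| + |b₁ - b₀|) := by ring
    _ ≤ s * (2 * t) := by gcongr
    _ = 2 * (s * t) := by ring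

/-! ### Decomposition into energy levels -/

/-- The unnormalised maximally entangled vector of the energy level `x`. -/
noncomputable def levelVec (E : a → ℝ) (x : ℝ) : a × a → ℂ :=
  fun p => if p.1 = p.2 ∧ E p.1 = x then 1 else 0

lemma star_levelVec_dotProduct_mulVec (E : a → ℝ) (x : ℝ) (M : Bip a a) :
    star (levelVec E x) ⬝ᵥ (M *ᵥ levelVec E x) =
      ∑ p with E p = x, ∑ q with E q = x, M (p, p) (q, q) := by
  simp only [dotProduct, mulVec, Fintype.sum_prod_type, levelVec, Pi.star_apply, apply_ite star,
    star_one, star_zero, ite_and, mul_ite, mul_one, mul_zero, ite_mul, one_mul, zero_mul,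
    Finset.sum_ite_eq, Finset.mem_univ, if_true, Finset.sum_filter]

lemma sum_apply_diag_eq_sum_levelVec (E : a → ℝ) (M : Bip a a)
    (h : ∀ p q, E p ≠ E q → M (p, p) (q, q) = 0) :
    ∑ p, ∑ q, M (p, p) (q, q) =
      ∑ x ∈ Finset.univ.image E, star (levelVec E x) ⬝ᵥ (M *ᵥ levelVec E x) := by
  rw [← Finset.sum_fiberwise_of_maps_to (s := Finset.univ) (t := Finset.univ.image E) (g := E)
    (fun p _ => Finset.mem_image_of_mem E (Finset.mem_univ p))]
  refine Finset.sum_congr rfl fun x _ => ?_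
  rw [star_levelVec_dotProduct_mulVec]
  refine Finset.sum_congr rfl fun p hp => ?_
  rw [Finset.sum_filter]
  refine Finset.sum_congr rfl fun q _ => ?_
  split_ifs with hq
  · rfl
  · exact h p q fun hpq => hq (hpq ▸ (Finset.mem_filter.1 hp).2)

lemma apply_eq_zero_of_commute_diagonal {E : a → ℝ} {X : Matrix a a ℂ}
    (h : Commute X (diagonal fun i => (E i : ℂ))) {p q : a} (hpq : E p ≠ E q) : X p q = 0 := by
  have := congrFun (congrFun h.eq p) q
  rw [mul_diagonal, diagonal_mul] at this
  have h2 : X p q * ((E q : ℂ) - (E p : ℂ)) = 0 := by linear_combination this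
  refine (mul_eq_zero.1 h2).resolve_right ?_
  exact fun h' => hpq (Complex.ofReal_injective (sub_eq_zero.1 h')).symm

/-- The factor between the CHSH bound of an energy level and its dimension. -/
noncomputable def levelFactor (D : ℕ) : ℝ := if D = 1 then 2 else 2 * Real.sqrt 2

lemma norm_conj_chshOp_levelVec_le {E : a → ℝ} {HA HB : Matrix a a ℂ} {A B : Fin 2 → Matrix a a ℂ}
    (hA : ∀ x, IsIncoherentObservable HA (A x)) (hB : ∀ y, IsIncoherentObservable HB (B y))
    (K L : Matrix a a ℂ) (x : ℝ) :
    ‖star (levelVec E x) ⬝ᵥ (((K ⊗ₖ L)ᴴ * chshOp A B * (K ⊗ₖ L)) *ᵥ levelVec E x)‖ ≤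
      levelFactor (Finset.univ.filter fun p => E p = x).card *
        (star (levelVec E x) ⬝ᵥ (((K ⊗ₖ L)ᴴ * (K ⊗ₖ L)) *ᵥ levelVec E x)).re := by
  unfold levelFactor
  split_ifs with h
  · obtain ⟨p, hp⟩ := Finset.card_eq_one.1 h
    rw [star_levelVec_dotProduct_mulVec, star_levelVec_dotProduct_mulVec, hp]
    simp only [Finset.sum_singleton]
    exact norm_conj_chshOp_apply_self_le hA hB K L p p
  · exact norm_conj_chshOp_le hA hB K L _

/-- The CHSH bound for separable instruments and block-diagonal observables. -/
lemma IsSepInstrument.norm_sum_chsh_le {E : a → ℝ} {HB : Matrix a a ℂ} {ι : Type} [Fintype ι]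
    {F : Bip a a → ι → Bip a a}
    (hF : IsSepInstrument (diagonal fun i => (E i : ℂ)) F) {A B : ι → Fin 2 → Matrix a a ℂ}
    (hA : ∀ m x, IsIncoherentObservable (diagonal fun i => (E i : ℂ)) (A m x))
    (hB : ∀ m y, IsIncoherentObservable HB (B m y)) (c : ℝ) (hc : 0 ≤ c) (ρ : Bip a a)
    (hρ : ∀ M : Bip a a, (M * ρ).trace = (c : ℂ) * ∑ p, ∑ q, M (p, p) (q, q)) :
    ‖∑ m, chsh (A m) (B m) (F ρ m)‖ ≤ c * ∑ x ∈ Finset.univ.image E,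
      levelFactor (Finset.univ.filter fun p => E p = x).card *
        (Finset.univ.filter fun p => E p = x).card := by
  obtain ⟨κ, _, K, L, hs, h1, hK⟩ := hF
  have hH : (diagonal fun i => (E i : ℂ)).IsHermitian := by
    rw [IsHermitian, diagonal_conjTranspose]
    congr 1; ext i; simp
  let M : ∀ m, κ m → Bip a a := fun m k =>
    (K m k ⊗ₖ L m k)ᴴ * chshOp (A m) (B m) * (K m k ⊗ₖ L m k)
  let G : ∀ m, κ m → Bip a a := fun m k => (K m k ⊗ₖ L m k)ᴴ * (K m k ⊗ₖ L m k)
  have e1 : ∑ m, chsh (A m) (B m) (F ρ m) = (c : ℂ) * ∑ x ∈ Finset.univ.image E,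
      ∑ m, ∑ k, star (levelVec E x) ⬝ᵥ (M m k *ᵥ levelVec E x) := by
    have : ∀ m, chsh (A m) (B m) (F ρ m) = ∑ k, (c : ℂ) * ∑ x ∈ Finset.univ.image E,
        star (levelVec E x) ⬝ᵥ (M m k *ᵥ levelVec E x) := by
      intro m
      rw [chsh, hK, Finset.mul_sum, trace_sum]
      refine Finset.sum_congr rfl fun k _ => ?_
      rw [← sum_apply_diag_eq_sum_levelVec, ← hρ]
      · simp only [M, Matrix.mul_assoc]
        rw [← Matrix.mul_assoc, ← Matrix.mul_assoc, Matrix.trace_mul_comm]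
        simp only [Matrix.mul_assoc]
      · intro p q hpq
        have hz : ∀ x, ((K m k)ᴴ * A m x * K m k) p q = 0 := fun x =>
          apply_eq_zero_of_commute_diagonal ((hs m k).commute_conj hH (hA m x).2.2.2) hpq
        simp only [M]
        rw [conj_chshOp]
        simp only [chshOp, Matrix.add_apply, Matrix.sub_apply,
          kroneckerMap_apply, hz, zero_mul, add_zero, sub_zero]
    simp only [this, ← Finset.mul_sum]
    congr 1
    rw [Finset.sum_comm]
    refine Finset.sum_congr rfl fun m _ => ?_
    rw [Finset.sum_comm]
  have e2 : ∀ x, ∑ m, ∑ k, (star (levelVec E x) ⬝ᵥ (G m k *ᵥ levelVec E x)).re =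
      (Finset.univ.filter fun p => E p = x).card := by
    intro x
    have : ∑ m, ∑ k, star (levelVec E x) ⬝ᵥ (G m k *ᵥ levelVec E x) =
        star (levelVec E x) ⬝ᵥ ((1 : Bip a a) *ᵥ levelVec E x) := by
      rw [← h1]
      simp only [sum_mulVec, dotProduct_sum, G]
    rw [star_levelVec_dotProduct_mulVec] at this
    have h2 := congrArg Complex.re this
    simp only [Complex.re_sum] at h2
    rw [h2, Finset.cast_card]
    refine Finset.sum_congr rfl fun p hp => ?_
    rw [Finset.sum_eq_single_of_mem p hp]
    · simp
    · intro q _ hq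
      rw [Matrix.one_apply_ne]
      · simp
      · exact fun h => hq (congrArg Prod.fst h).symm
  rw [e1, norm_mul, Complex.norm_real, Real.norm_of_nonneg hc]
  refine mul_le_mul_of_nonneg_left ((norm_sum_le _ _).trans (Finset.sum_le_sum fun x _ => ?_)) hc
  rw [← e2, Finset.mul_sum]
  refine (norm_sum_le _ _).trans (Finset.sum_le_sum fun m _ => ?_)
  rw [Finset.mul_sum]
  refine (norm_sum_le _ _).trans (Finset.sum_le_sum fun k _ => ?_)
  exact norm_conj_chshOp_levelVec_le (hA m) (hB m) (K m k) (L m k) x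

/-! ### Copies of a maximally entangled state -/

lemma copies_maxEnt_apply (d n : ℕ) (p : (Fin n → Fin d) × (Fin n → Fin d)) :
    copies n (maxEnt d) p = if p.1 = p.2 then (((Real.sqrt d)⁻¹ ^ n : ℝ) : ℂ) else 0 := by
  unfold copies maxEnt
  split_ifs with h
  · simp [h]
  · obtain ⟨k, hk⟩ := Function.ne_iff.1 h
    exact Finset.prod_eq_zero (Finset.mem_univ k) (by simp [hk])

lemma trace_mul_sharedState (d n : ℕ) (M : Bip (Fin n → Fin d) (Fin n → Fin d)) :
    (M * sharedState d n).trace =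
      ((((d : ℝ) ^ n)⁻¹ : ℝ) : ℂ) * ∑ p, ∑ q, M (p, p) (q, q) := by
  have hc : ((((d : ℝ) ^ n)⁻¹ : ℝ) : ℂ) =
      (((Real.sqrt d)⁻¹ ^ n : ℝ) : ℂ) * (((Real.sqrt d)⁻¹ ^ n : ℝ) : ℂ) := by
    rw [← Complex.ofReal_mul, ← mul_pow, ← mul_inv, Real.mul_self_sqrt (Nat.cast_nonneg d), inv_pow]
  rw [hc, sharedState, mul_vecMulVec, trace_vecMulVec]
  simp only [dotProduct, mulVec, Fintype.sum_prod_type, Pi.star_apply, copies_maxEnt_apply,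
    apply_ite star, star_zero, mul_ite, mul_zero, Complex.star_def, Complex.conj_ofReal,
    Finset.sum_ite_eq, Finset.mem_univ, if_true, ← Finset.sum_mul]
  ring

lemma sum_levelFactor_eq {d : ℕ} (n : ℕ) (E : Fin d → ℝ) :
    ((d : ℝ) ^ n)⁻¹ * ∑ x ∈ Finset.univ.image (energy n E),
      levelFactor (Finset.univ.filter fun p => energy n E p = x).card *
        (Finset.univ.filter fun p => energy n E p = x).card = chshBound n E := by
  have key : ∑ x ∈ levels n E, levelFactor (levelDim n E x) * (levelDim n E x : ℝ) =
      2 * ((Dndeg n E : ℝ) + Real.sqrt 2 * (Ddeg n E : ℝ)) := by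
    rw [Dndeg, Ddeg, Finset.sum_filter, Finset.sum_filter]
    push_cast
    rw [Finset.mul_sum, ← Finset.sum_add_distrib, Finset.mul_sum]
    refine Finset.sum_congr rfl fun x _ => ?_
    unfold levelFactor
    rcases lt_trichotomy (levelDim n E x) 1 with h | h | h
    · simp [Nat.lt_one_iff.1 h]
    · simp [h]
    · rw [if_neg h.ne', if_neg h.ne', if_pos (show 2 ≤ _ from h)]
      ring
  rw [chshBound, ← key, div_eq_inv_mul]
  rfl

lemma IsSepInstrument.norm_sum_chsh_sharedState_le {d n : ℕ} {EA EB : Fin d → ℝ} {ι : Type}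
    [Fintype ι] {F : Bip (Fin n → Fin d) (Fin n → Fin d) → ι → Bip (Fin n → Fin d) (Fin n → Fin d)}
    (hF : IsSepInstrument (hamiltonian n EA) F)
    {A B : ι → Fin 2 → Matrix (Fin n → Fin d) (Fin n → Fin d) ℂ}
    (hA : ∀ m x, IsIncoherentObservable (hamiltonian n EA) (A m x))
    (hB : ∀ m y, IsIncoherentObservable (hamiltonian n EB) (B m y)) :
    ‖∑ m, chsh (A m) (B m) (F (sharedState d n) m)‖ ≤ chshBound n EA := by
  rw [← sum_levelFactor_eq]
  exact IsSepInstrument.norm_sum_chsh_le (E := energy n EA) hF hA hB _ (by positivity) _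
    (trace_mul_sharedState d n)

end LTOCC

theorem mainTheorem5 (d n : ℕ) (hd : 0 < d) (hn : 0 < n) (βA βB : ℝ)
    (EA EB : Fin d → ℝ) (hA : Function.Injective EA) (hB : Function.Injective EB)
    (hAB : ∀ i j : Fin n → Fin d,
      LTOCC.energy n EA i = LTOCC.energy n EA j ↔ LTOCC.energy n EB i = LTOCC.energy n EB j) :
    -- protocols without memory
    (∀ (r : ℕ) (Λ : LTOCC.Bip (Fin n → Fin d) (Fin n → Fin d) →
          LTOCC.Bip (Fin n → Fin d) (Fin n → Fin d)),
        LTOCC.IsLTOCC βA βB (LTOCC.hamiltonian n EA) (LTOCC.hamiltonian n EB) r Λ →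
        ∀ A B : Fin 2 → Matrix (Fin n → Fin d) (Fin n → Fin d) ℂ,
          (∀ x, LTOCC.IsIncoherentObservable (LTOCC.hamiltonian n EA) (A x)) →
          (∀ y, LTOCC.IsIncoherentObservable (LTOCC.hamiltonian n EB) (B y)) →
          ‖LTOCC.chsh A B (Λ (LTOCC.sharedState d n))‖ ≤ LTOCC.chshBound n EA) ∧
    -- protocols with memory, the memory being traced out at the end
    (∀ (r : ℕ) (Λ : LTOCC.Bip (Fin n → Fin d) (Fin n → Fin d) →
          LTOCC.Bip (Fin n → Fin d) (Fin n → Fin d)),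
        LTOCC.IsLTOCCM βA βB (LTOCC.hamiltonian n EA) (LTOCC.hamiltonian n EB) r Λ →
        ∀ A B : Fin 2 → Matrix (Fin n → Fin d) (Fin n → Fin d) ℂ,
          (∀ x, LTOCC.IsIncoherentObservable (LTOCC.hamiltonian n EA) (A x)) →
          (∀ y, LTOCC.IsIncoherentObservable (LTOCC.hamiltonian n EB) (B y)) →
          ‖LTOCC.chsh A B (Λ (LTOCC.sharedState d n))‖ ≤ LTOCC.chshBound n EA) ∧
    -- protocols with memory, the final observables being allowed to depend on the memory
    (∀ (N r : ℕ) (F : LTOCC.Bip (Fin n → Fin d) (Fin n → Fin d) →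
          LTOCC.MemState (Fin n → Fin d) (Fin n → Fin d) N r),
        LTOCC.IsMemProtocol βA βB (LTOCC.hamiltonian n EA) (LTOCC.hamiltonian n EB) N r F →
        ∀ A B : (Fin r → Fin N) → Fin 2 → Matrix (Fin n → Fin d) (Fin n → Fin d) ℂ,
          (∀ m x, LTOCC.IsIncoherentObservable (LTOCC.hamiltonian n EA) (A m x)) →
          (∀ m y, LTOCC.IsIncoherentObservable (LTOCC.hamiltonian n EB) (B m y)) →
          ‖∑ m, LTOCC.chsh (A m) (B m) (F (LTOCC.sharedState d n) m)‖ ≤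
            LTOCC.chshBound n EA) := by
  refine ⟨fun r Λ h A B hA' hB' => ?_, fun r Λ h A B hA' hB' => ?_, fun N r F h A B hA' hB' =>
    h.isSepInstrument.norm_sum_chsh_sharedState_le hA' hB'⟩
  · simpa using h.isSepInstrument.norm_sum_chsh_sharedState_le
      (A := fun _ => A) (B := fun _ => B) (fun _ => hA') (fun _ => hB')
  · obtain ⟨N, F, hF, hΛ⟩ := h
    simpa [← hΛ] using hF.isSepInstrument.sum.norm_sum_chsh_sharedState_le
      (A := fun _ => A) (B := fun _ => B) (fun _ => hA') (fun _ => hB')
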